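/- **Theorem.** Let $n\ge 2$ be an integer. Let $Q_n=\langle x,y : x^{2n}=1,\ x^n=y^2,\ y^{-1}xy=x^{-1}\rangle$ be the dicyclic group of order $4n$ and let $D_n=\langle r,s : r^n=s^2=1,\ srs=r^{-1}\rangle$ be the dihedral group of order $2n$. For a finite group $G$, let $\Gamma(G)$ be its generating graph: the vertex set is $G$, and two distinct elements $g,h$ are adjacent if and only if $\langle g,h\rangle=G$. Let $L(Q_n)$ and $L(D_n)$ be the Laplacian matrices (degree matrix minus adjacency matrix) of $\Gamma(Q_n)$ and $\Gamma(D_n)$. Let $n_0$ be the product of the distinct prime divisors of $n$, let $\varphi$ be Euler's totient function and $\mu$ the Möbius function. (1) If $\lambda$ is an eigenvalue of $L(D_n)$, then $2\lambda$ is an eigenvalue of $L(Q_n)$. (2) The complete spectrum of $L(Q_n)$, as a multiset of $4n$ eigenvalues, consists of - $0$ with multiplicity $2(n-\varphi(n))+1$; - for each divisor $d>1$ of $n_0$, the value $4\varphi(n)-2\mu(d)\dfrac{\varphi(n)}{\varphi(d)}$ with multiplicity $\varphi(d)$; - $4\varphi(n)$ with multiplicity $2n-n_0$; - $2n$ with multiplicity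 $2\varphi(n)-1$; - $2(n+\varphi(n))$ with multiplicity $1$. If some of the listed values coincide, their multiplicities are added. -/

import Mathlib

/-- The generating graph `Γ(G)` of a group `G`: the vertices are the elements of `G`, and two
distinct elements are adjacent iff together they generate `G`. -/
def generatingGraph (G : Type*) [Group G] : SimpleGraph G where
  Adj g h := g ≠ h ∧ Subgroup.closure ({g, h} : Set G) = ⊤
  symm := ⟨fun g h hgh => ⟨hgh.1.symm, by rw [Set.pair_comm]; exact hgh.2⟩⟩
  loopless := ⟨fun _ hg => hg.1 rfl⟩

noncomputable instance generatingGraphDecidableAdj (G : Type*) [Group G] :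
    DecidableRel (generatingGraph G).Adj :=
  Classical.decRel _

/-- The Laplacian matrix (degree matrix minus adjacency matrix) of the generating graph of a
finite group, as a real matrix. -/
noncomputable def generatingLaplacian (G : Type*) [Group G] [Fintype G] [DecidableEq G] :
    Matrix G G ℝ :=
  (generatingGraph G).lapMatrix ℝ

/-- The real eigenvalues of a square real matrix, each repeated according to its multiplicity as a
root of the characteristic polynomial. -/
noncomputable def eigenvalueMultiset {ι : Type*} [Fintype ι] [DecidableEq ι]
    (M : Matrix ι ι ℝ) : Multiset ℝ :=
  M.charpoly.roots

/-! The kernel of `toDihedral` is `{1, a n}`, and `a n` is the square of every `xa j`. A generating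
pair of either group contains an element outside the cyclic part, so a pair generates `Q_n` exactly
when its image generates `D_n` (`closure_pair_eq_top_iff`). Thus each vertex of `Γ(D_n)` is doubled
in `Γ(Q_n)`, and pulling an eigenvector back doubles its eigenvalue, which is (1).

For (2), adjacency is explicit: two `a`'s are never adjacent, `a i` and `xa j` are adjacent iff `i`
is coprime to `n`, and `xa i` and `xa j` iff `j - i` is. On the `xa` coset the graph is therefore a
Cayley graph, diagonalised by the additive characters of `ZMod (2 * n)`. A nontrivial character of
order `e` has eigenvalue `4φ(n)` minus a Ramanujan-type sum, equal to `2μ(e)φ(n)/φ(e)` if `e ∣ n`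
and to `0` otherwise (`sum_isUnitMod_stdAddChar`). The remaining eigenvectors live on isolated
vertices, on differences of unit rotations, or are constant on the unit rotations and on the coset.
Their independence (`linearIndependent_eigenvector`) yields the whole spectrum, and grouping
characters by order gives the multiplicities. -/

namespace QuaternionGroup

/-! ### The quotient map and reduction modulo `n` -/

/-- The quotient map of the dicyclic group of order `4n` by its centre, onto the dihedral group of
order `2n`. -/
def toDihedral (n : ℕ) : QuaternionGroup n →* DihedralGroup n where
  toFun
    | a i => .r (ZMod.castHom (dvd_mul_left n 2) (ZMod n) i)
    | xa i => .sr (ZMod.castHom (dvd_mul_left n 2) (ZMod n) i)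
  map_one' := by
    rw [one_def]
    exact congrArg DihedralGroup.r (map_zero _)
  map_mul' := by
    rintro (i | i) (j | j) <;>
      simp only [a_mul_a, a_mul_xa, xa_mul_a, xa_mul_xa, DihedralGroup.r_mul_r,
        DihedralGroup.r_mul_sr, DihedralGroup.sr_mul_r, DihedralGroup.sr_mul_sr, map_add, map_sub,
        map_natCast, CharP.cast_eq_zero, zero_add]

theorem toDihedral_a {n : ℕ} (i : ZMod (2 * n)) :
    toDihedral n (a i) = .r (ZMod.castHom (dvd_mul_left n 2) (ZMod n) i) := rfl

theorem toDihedral_xa {n : ℕ} (i : ZMod (2 * n)) :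
    toDihedral n (xa i) = .sr (ZMod.castHom (dvd_mul_left n 2) (ZMod n) i) := rfl

end QuaternionGroup

theorem ZMod.castHom_two_mul_eq_zero_iff {n : ℕ} [NeZero n] (i : ZMod (2 * n)) :
    ZMod.castHom (dvd_mul_left n 2) (ZMod n) i = 0 ↔ i = 0 ∨ i = (n : ZMod (2 * n)) := by
  constructor
  · intro h
    obtain ⟨m, rfl⟩ := ZMod.natCast_zmod_surjective i
    rw [map_natCast, ZMod.natCast_eq_zero_iff] at h
    obtain ⟨k, rfl⟩ := h
    have h2 : ((2 * n : ℕ) : ZMod (2 * n)) = 0 := ZMod.natCast_self _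
    -- Modulo `2n`, a multiple `n * k` depends only on the parity of `k`.
    obtain ⟨c, rfl | rfl⟩ := Nat.even_or_odd' k
    · left
      rw [show n * (2 * c) = 2 * n * c by ring, Nat.cast_mul, h2, zero_mul]
    · right
      rw [show n * (2 * c + 1) = 2 * n * c + n by ring, Nat.cast_add, Nat.cast_mul, h2, zero_mul,
        zero_add]
  · rintro (rfl | rfl) <;> simp

theorem ZMod.castHom_two_mul_eq_iff {n : ℕ} [NeZero n] (i j : ZMod (2 * n)) :
    ZMod.castHom (dvd_mul_left n 2) (ZMod n) i = ZMod.castHom (dvd_mul_left n 2) (ZMod n) j ↔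
      i = j ∨ i = j + (n : ZMod (2 * n)) := by
  rw [← sub_eq_zero, ← map_sub, ZMod.castHom_two_mul_eq_zero_iff, sub_eq_zero, sub_eq_iff_eq_add']

theorem ZMod.natCast_ne_zero_two_mul {n : ℕ} [NeZero n] : (n : ZMod (2 * n)) ≠ 0 := by
  rw [Ne, ZMod.natCast_eq_zero_iff]
  intro h
  have := Nat.le_of_dvd (NeZero.pos n) h
  have := NeZero.pos n
  omega

theorem ZMod.sum_comp_castHom_two_mul {n : ℕ} [NeZero n] {M : Type*} [AddCommMonoid M]
    (f : ZMod n → M) :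
    ∑ i : ZMod (2 * n), f (ZMod.castHom (dvd_mul_left n 2) (ZMod n) i) = 2 • ∑ j, f j := by
  classical
  rw [← Finset.sum_fiberwise_of_maps_to (t := Finset.univ)
    (g := ZMod.castHom (dvd_mul_left n 2) (ZMod n)) (fun _ _ => Finset.mem_univ _),
    Finset.smul_sum]
  refine Finset.sum_congr rfl fun j _ => ?_
  obtain ⟨i, rfl⟩ := ZMod.castHom_surjective (dvd_mul_left n 2) j
  rw [Finset.sum_congr rfl (g := fun _ => f (ZMod.castHom (dvd_mul_left n 2) (ZMod n) i))
    (by intro k hk; rw [(Finset.mem_filter.1 hk).2]), Finset.sum_const]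
  congr 1
  have : (Finset.univ.filter fun k : ZMod (2 * n) => ZMod.castHom (dvd_mul_left n 2) (ZMod n) k =
      ZMod.castHom (dvd_mul_left n 2) (ZMod n) i) = {i, i + (n : ZMod (2 * n))} := by
    ext k
    simp only [Finset.mem_filter, Finset.mem_univ, true_and, Finset.mem_insert,
      Finset.mem_singleton]
    exact ZMod.castHom_two_mul_eq_iff k i
  rw [this, Finset.card_pair]
  simpa using ZMod.natCast_ne_zero_two_mul

/-! ### Generating pairs of the dihedral group -/

namespace DihedralGroup

theorem r_mem_of_isUnit {n : ℕ} {H : Subgroup (DihedralGroup n)} {i : ZMod n} (hi : IsUnit i)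
    (h : r i ∈ H) (j : ZMod n) : r j ∈ H := by
  obtain ⟨u, rfl⟩ := hi
  obtain ⟨m, hm⟩ := ZMod.intCast_surjective (((u⁻¹ : (ZMod n)ˣ) : ZMod n) * j)
  have := H.zpow_mem h m
  rwa [r_zpow, hm, ← mul_assoc, Units.mul_inv, one_mul] at this

theorem eq_top_of_r_mem_of_sr_mem {n : ℕ} {H : Subgroup (DihedralGroup n)} {i j : ZMod n}
    (hi : IsUnit i) (hr : r i ∈ H) (hs : sr j ∈ H) : H = ⊤ := by
  refine (Subgroup.eq_top_iff' H).2 ?_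
  rintro (k | k)
  · exact r_mem_of_isUnit hi hr k
  · have := H.mul_mem hs (r_mem_of_isUnit hi hr (k - j))
    rwa [sr_mul_r, add_sub_cancel] at this

/-- The subgroup of the dihedral group formed by the rotations `r k` with `k` in an additive
subgroup `K` and the reflections `sr k` with `k` in the coset `j + K`. -/
def cosetSubgroup {n : ℕ} (K : AddSubgroup (ZMod n)) (j : ZMod n) : Subgroup (DihedralGroup n) where
  carrier := {g | match g with
    | r k => k ∈ K
    | sr k => k - j ∈ K}
  one_mem' := K.zero_mem
  mul_mem' := by
    rintro (s | s) (t | t) (hs : _ ∈ K) (ht : _ ∈ K)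
    · exact K.add_mem hs ht
    · change t - s - j ∈ K
      simpa [sub_right_comm] using K.sub_mem ht hs
    · change s + t - j ∈ K
      simpa [sub_add_eq_add_sub] using K.add_mem hs ht
    · change t - s ∈ K
      simpa using K.sub_mem ht hs
  inv_mem' := by
    rintro (s | s) (hs : _ ∈ K)
    · exact K.neg_mem hs
    · exact hs

/-- The obstruction to generation: if this subgroup is everything, it contains `r 1`, so `1` is a
multiple of `i`. -/
theorem isUnit_of_cosetSubgroup_eq_top {n : ℕ} {i j : ZMod n}
    (h : cosetSubgroup (AddSubgroup.zmultiples i) j = ⊤) : IsUnit i := by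
  have h1 : r 1 ∈ cosetSubgroup (AddSubgroup.zmultiples i) j := h ▸ Subgroup.mem_top _
  obtain ⟨m, hm⟩ := AddSubgroup.mem_zmultiples_iff.1 (show (1 : ZMod n) ∈ _ from h1)
  exact IsUnit.of_mul_eq_one_right (m : ZMod n) (by rwa [zsmul_eq_mul] at hm)

theorem closure_r_r_ne_top {n : ℕ} (i j : ZMod n) :
    Subgroup.closure ({r i, r j} : Set (DihedralGroup n)) ≠ ⊤ := by
  intro h
  have hle : Subgroup.closure ({r i, r j} : Set (DihedralGroup n)) ≤ Subgroup.zpowers (r 1) := by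
    rw [Subgroup.closure_le]
    rintro _ (rfl | rfl)
    · exact r_mem_of_isUnit isUnit_one (Subgroup.mem_zpowers _) _
    · exact r_mem_of_isUnit isUnit_one (Subgroup.mem_zpowers _) _
  obtain ⟨m, hm⟩ := Subgroup.mem_zpowers_iff.1 (hle (h ▸ Subgroup.mem_top (sr (0 : ZMod n))))
  rw [r_zpow] at hm
  cases hm

theorem closure_r_sr_eq_top_iff {n : ℕ} (i j : ZMod n) :
    Subgroup.closure ({r i, sr j} : Set (DihedralGroup n)) = ⊤ ↔ IsUnit i := by
  constructor
  · intro h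
    refine isUnit_of_cosetSubgroup_eq_top (j := j) (top_le_iff.1 ?_)
    rw [← h, Subgroup.closure_le]
    rintro _ (rfl | rfl)
    · exact AddSubgroup.mem_zmultiples i
    · change j - j ∈ AddSubgroup.zmultiples i
      simp
  · intro h
    exact eq_top_of_r_mem_of_sr_mem h (Subgroup.subset_closure (Set.mem_insert _ _))
      (Subgroup.subset_closure (Set.mem_insert_of_mem _ rfl))

theorem closure_sr_sr_eq_top_iff {n : ℕ} (i j : ZMod n) :
    Subgroup.closure ({sr i, sr j} : Set (DihedralGroup n)) = ⊤ ↔ IsUnit (j - i) := by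
  constructor
  · intro h
    refine isUnit_of_cosetSubgroup_eq_top (j := i) (top_le_iff.1 ?_)
    rw [← h, Subgroup.closure_le]
    rintro _ (rfl | rfl)
    · change i - i ∈ AddSubgroup.zmultiples (j - i)
      simp
    · exact AddSubgroup.mem_zmultiples (j - i)
  · intro h
    have hi : sr i ∈ Subgroup.closure ({sr i, sr j} : Set (DihedralGroup n)) :=
      Subgroup.subset_closure (Set.mem_insert _ _)
    have hj : sr j ∈ Subgroup.closure ({sr i, sr j} : Set (DihedralGroup n)) :=
      Subgroup.subset_closure (Set.mem_insert_of_mem _ rfl)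
    refine eq_top_of_r_mem_of_sr_mem h ?_ hi
    simpa using Subgroup.mul_mem _ hi hj

/-- A dihedral group is never cyclic for `n ≥ 2`. -/
theorem closure_pair_self_ne_top {n : ℕ} (hn : 2 ≤ n) (g : DihedralGroup n) :
    Subgroup.closure ({g, g} : Set (DihedralGroup n)) ≠ ⊤ := by
  have : Fact (1 < n) := ⟨hn⟩
  obtain i | i := g
  · exact closure_r_r_ne_top i i
  · rw [Ne, closure_sr_sr_eq_top_iff, sub_self]
    exact not_isUnit_zero

theorem generatingGraph_adj_iff {n : ℕ} (hn : 2 ≤ n) (g h : DihedralGroup n) :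
    (generatingGraph (DihedralGroup n)).Adj g h ↔
      Subgroup.closure ({g, h} : Set (DihedralGroup n)) = ⊤ :=
  ⟨fun H => H.2, fun H => ⟨by rintro rfl; exact closure_pair_self_ne_top hn g H, H⟩⟩

end DihedralGroup

/-! ### Lifting generation from `D_n` to `Q_n` -/

namespace QuaternionGroup

variable {n : ℕ}

theorem ker_toDihedral_le [NeZero n] {H : Subgroup (QuaternionGroup n)} {j : ZMod (2 * n)}
    (h : xa j ∈ H) : (toDihedral n).ker ≤ H := by
  rintro (i | i) hi
  · rw [MonoidHom.mem_ker, toDihedral_a, DihedralGroup.one_def, DihedralGroup.r.injEq,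
      ZMod.castHom_two_mul_eq_zero_iff] at hi
    obtain rfl | rfl := hi
    · exact H.one_mem
    · simpa using H.mul_mem h h
  · rw [MonoidHom.mem_ker, toDihedral_xa] at hi
    cases hi

theorem toDihedral_surjective : Function.Surjective (toDihedral n) := by
  rintro (j | j) <;> obtain ⟨i, rfl⟩ := ZMod.castHom_surjective (dvd_mul_left n 2) j
  · exact ⟨a i, rfl⟩
  · exact ⟨xa i, rfl⟩

theorem map_closure_pair (g h : QuaternionGroup n) :
    (Subgroup.closure {g, h}).map (toDihedral n) =
      Subgroup.closure {toDihedral n g, toDihedral n h} := by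
  rw [MonoidHom.map_closure, Set.image_pair]

theorem closure_pair_eq_top_iff [NeZero n] (g h : QuaternionGroup n) :
    Subgroup.closure ({g, h} : Set (QuaternionGroup n)) = ⊤ ↔
      Subgroup.closure ({toDihedral n g, toDihedral n h} : Set (DihedralGroup n)) = ⊤ := by
  rw [← map_closure_pair]
  constructor
  · intro H
    rw [H, ← MonoidHom.range_eq_map, MonoidHom.range_eq_top]
    exact toDihedral_surjective
  · intro H
    -- Two rotations cannot generate `D_n`, so one of `g`, `h` is some `xa j`. The closure then
    -- contains the kernel and is the full preimage of its image.
    have hx : ∃ j, (xa j : QuaternionGroup n) ∈ Subgroup.closure ({g, h} : Set _) := by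
      obtain i | i := g
      · obtain j | j := h
        · rw [map_closure_pair] at H
          exact absurd H (DihedralGroup.closure_r_r_ne_top _ _)
        · exact ⟨j, Subgroup.subset_closure (Set.mem_insert_of_mem _ rfl)⟩
      · exact ⟨i, Subgroup.subset_closure (Set.mem_insert _ _)⟩
    obtain ⟨j, hj⟩ := hx
    rw [← Subgroup.comap_map_eq_self (ker_toDihedral_le hj), H, Subgroup.comap_top]

theorem generatingGraph_adj_iff [NeZero n] (hn : 2 ≤ n) (g h : QuaternionGroup n) :
    (generatingGraph (QuaternionGroup n)).Adj g h ↔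
      (generatingGraph (DihedralGroup n)).Adj (toDihedral n g) (toDihedral n h) := by
  rw [DihedralGroup.generatingGraph_adj_iff hn, ← closure_pair_eq_top_iff]
  refine ⟨fun H => H.2, fun H => ⟨?_, H⟩⟩
  rintro rfl
  rw [closure_pair_eq_top_iff] at H
  exact DihedralGroup.closure_pair_self_ne_top hn _ H

theorem sum_eq_sum_a_add_sum_xa [NeZero n] {M : Type*} [AddCommMonoid M]
    (f : QuaternionGroup n → M) : ∑ g, f g = ∑ i, f (a i) + ∑ i, f (xa i) := by
  let e : ZMod (2 * n) ⊕ ZMod (2 * n) ≃ QuaternionGroup n :=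
    { toFun := Sum.elim a xa
      invFun := fun | a i => .inl i | xa i => .inr i
      left_inv := by rintro (i | i) <;> rfl
      right_inv := by rintro (i | i) <;> rfl }
  rw [← e.sum_comp, Fintype.sum_sum_type]
  rfl

theorem sum_comp_toDihedral [NeZero n] {M : Type*} [AddCommMonoid M]
    (f : DihedralGroup n → M) : ∑ g, f (toDihedral n g) = 2 • ∑ g, f g := by
  let e : ZMod n ⊕ ZMod n ≃ DihedralGroup n :=
    { toFun := Sum.elim .r .sr
      invFun := fun | .r i => .inl i | .sr i => .inr i
      left_inv := by rintro (i | i) <;> rfl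
      right_inv := by rintro (i | i) <;> rfl }
  rw [sum_eq_sum_a_add_sum_xa, ← e.sum_comp, Fintype.sum_sum_type, smul_add]
  simp only [toDihedral_a, toDihedral_xa]
  rw [ZMod.sum_comp_castHom_two_mul (fun j => f (.r j)),
    ZMod.sum_comp_castHom_two_mul (fun j => f (.sr j))]
  rfl

end QuaternionGroup

/-! ### Pulling back the Laplacian -/

open scoped Classical in
theorem SimpleGraph.lapMatrix_mulVec_apply_eq_sum_ite {V R : Type*} [Fintype V] [DecidableEq V]
    (G : SimpleGraph V) [DecidableRel G.Adj] [Ring R] (v : V → R) (i : V) :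
    (G.lapMatrix R).mulVec v i = ∑ j, if G.Adj i j then v i - v j else 0 := by
  rw [SimpleGraph.lapMatrix_mulVec_apply, ← Finset.sum_filter, Finset.sum_sub_distrib,
    Finset.sum_const, nsmul_eq_mul]
  congr 2
  · rw [← SimpleGraph.card_neighborFinset_eq_degree]
    congr 2
    ext; simp
  · ext; simp

open scoped Classical in
theorem QuaternionGroup.lapMatrix_mulVec_comp_toDihedral {n : ℕ} [NeZero n] (hn : 2 ≤ n)
    (v : DihedralGroup n → ℝ) (g : QuaternionGroup n) :
    (generatingLaplacian (QuaternionGroup n)).mulVec (v ∘ toDihedral n) g =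
      2 * (generatingLaplacian (DihedralGroup n)).mulVec v (toDihedral n g) := by
  unfold generatingLaplacian
  rw [SimpleGraph.lapMatrix_mulVec_apply_eq_sum_ite,
    SimpleGraph.lapMatrix_mulVec_apply_eq_sum_ite]
  simp only [generatingGraph_adj_iff hn, Function.comp_apply]
  rw [sum_comp_toDihedral (fun h => if (generatingGraph (DihedralGroup n)).Adj (toDihedral n g) h
    then v (toDihedral n g) - v h else 0), nsmul_eq_mul]
  norm_num

theorem QuaternionGroup.hasEigenvalue_two_mul {n : ℕ} [NeZero n] (hn : 2 ≤ n) {l : ℝ}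
    (h : Module.End.HasEigenvalue (Matrix.toLin' (generatingLaplacian (DihedralGroup n))) l) :
    Module.End.HasEigenvalue (Matrix.toLin' (generatingLaplacian (QuaternionGroup n))) (2 * l) := by
  obtain ⟨v, hv⟩ := h.exists_hasEigenvector
  refine Module.End.hasEigenvalue_of_hasEigenvector (x := v ∘ toDihedral n)
    ⟨Module.End.mem_eigenspace_iff.2 ?_, ?_⟩
  · ext g
    have := congrFun hv.apply_eq_smul (toDihedral n g)
    rw [Matrix.toLin'_apply] at this ⊢
    rw [lapMatrix_mulVec_comp_toDihedral hn, this]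
    simp [mul_assoc]
  · intro h0
    refine hv.2 (funext fun d => ?_)
    obtain ⟨g, rfl⟩ := toDihedral_surjective d
    exact congrFun h0 g

/-! ### Ramanujan-type sums -/

theorem sum_nthRootsFinset_one {n : ℕ} (hn : 0 < n) :
    ∑ z ∈ Polynomial.nthRootsFinset n (1 : ℂ), z = if n = 1 then 1 else 0 := by
  split_ifs with h1
  · subst h1
    simp [Polynomial.nthRootsFinset, Polynomial.nthRoots,
      Polynomial.roots_X_sub_C, -map_one]
  · have : NeZero n := ⟨hn.ne'⟩
    have hζ := Complex.isPrimitiveRoot_exp n hn.ne'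
    set ζ := Complex.exp (2 * Real.pi * Complex.I / n)
    have hζ1 : ζ ≠ 1 := hζ.ne_one (by omega)
    have hmem : ∀ w : ℂ, w ^ n = 1 → ∀ z ∈ Polynomial.nthRootsFinset n (1 : ℂ),
        w * z ∈ Polynomial.nthRootsFinset n (1 : ℂ) := by
      intro w hw z hz
      rw [Polynomial.mem_nthRootsFinset hn] at hz ⊢
      rw [mul_pow, hw, hz, one_mul]
    -- Multiplication by `ζ ≠ 1` permutes the roots, so the sum is fixed by `ζ` and vanishes.
    have key : ∑ z ∈ Polynomial.nthRootsFinset n (1 : ℂ), z =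
        ∑ z ∈ Polynomial.nthRootsFinset n (1 : ℂ), ζ * z := by
      refine Finset.sum_bij' (fun z _ => ζ⁻¹ * z) (fun z _ => ζ * z)
        (hmem _ (by rw [inv_pow, hζ.pow_eq_one, inv_one])) (hmem _ hζ.pow_eq_one) ?_ ?_ ?_ <;>
        intro z _ <;> simp [hζ.ne_zero hn.ne']
    rw [← Finset.mul_sum] at key
    exact (mul_eq_zero.1 (by linear_combination key : (1 - ζ) * _ = 0)).resolve_left
      (sub_ne_zero.2 hζ1.symm)

/-- Möbius inversion of `sum_nthRootsFinset_one`, the `m`-th roots of unity being partitioned by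
their order. -/
theorem sum_primitiveRoots_eq_moebius {n : ℕ} (hn : 0 < n) :
    ∑ z ∈ primitiveRoots n ℂ, z = (ArithmeticFunction.moebius n : ℂ) := by
  classical
  have h := (ArithmeticFunction.sum_eq_iff_sum_mul_moebius_eq
    (f := fun n => ∑ z ∈ primitiveRoots n ℂ, z) (g := fun n => if n = 1 then (1 : ℂ) else 0)).1
    (fun m hm => by
      rw [← sum_nthRootsFinset_one hm, IsPrimitiveRoot.nthRoots_one_eq_biUnion_primitiveRoots,
        Finset.sum_biUnion]
      intro a _ b _ hab
      exact IsPrimitiveRoot.disjoint hab) n hn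
  rw [← h, Finset.sum_eq_single (n, 1)]
  · simp
  · rintro ⟨a, b⟩ hab hne
    have : b ≠ 1 := by
      rintro rfl
      rw [Nat.mem_divisorsAntidiagonal] at hab
      exact hne (by rw [← hab.1, mul_one])
    simp [this]
  · intro h
    exact absurd (Nat.mem_divisorsAntidiagonal.2 ⟨mul_one n, hn.ne'⟩) h

theorem IsPrimitiveRoot.sum_units_zmodChar {e : ℕ} [NeZero e] {ζ : ℂ} (hζ : IsPrimitiveRoot ζ e) :
    ∑ u : (ZMod e)ˣ, AddChar.zmodChar e hζ.pow_eq_one (u : ZMod e) =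
      (ArithmeticFunction.moebius e : ℂ) := by
  classical
  rw [← sum_primitiveRoots_eq_moebius (NeZero.pos e)]
  have hinj : Function.Injective
      fun u : (ZMod e)ˣ => AddChar.zmodChar e hζ.pow_eq_one (u : ZMod e) := by
    intro u v huv
    simp only [AddChar.zmodChar_apply] at huv
    exact Units.ext (ZMod.val_injective e (hζ.pow_inj (ZMod.val_lt _) (ZMod.val_lt _) huv))
  have himage : (Finset.univ.image
      fun u : (ZMod e)ˣ => AddChar.zmodChar e hζ.pow_eq_one (u : ZMod e)) =
        primitiveRoots e ℂ := by
    refine Finset.eq_of_subset_of_card_le ?_ ?_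
    · intro z hz
      obtain ⟨u, -, rfl⟩ := Finset.mem_image.1 hz
      rw [mem_primitiveRoots (NeZero.pos e), AddChar.zmodChar_apply]
      exact hζ.pow_of_coprime _ (ZMod.val_coe_unit_coprime u)
    · rw [Finset.card_image_of_injective _ hinj, Finset.card_univ, ZMod.card_units_eq_totient,
        hζ.card_primitiveRoots]
  rw [← himage, Finset.sum_image hinj.injOn]

/-- All fibres have the same size. Cross-multiplying by the cardinalities avoids division in `R`. -/
theorem MonoidHom.card_mul_sum_comp {G H R : Type*} [Group G] [Group H] [Fintype G] [Fintype H]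
    [CommRing R] {f : G →* H} (hf : Function.Surjective f) (F : H → R) :
    (Fintype.card H : R) * ∑ g, F (f g) = Fintype.card G * ∑ h, F h := by
  classical
  have hfib : ∀ h : H, (Finset.univ.filter fun g => f g = h).card =
      (Finset.univ.filter fun g => f g = 1).card := fun h =>
    MonoidHom.card_fiber_eq_of_mem_range f (hf h) (hf 1)
  have hcard : Fintype.card G =
      Fintype.card H * (Finset.univ.filter fun g => f g = 1).card := by
    rw [← Finset.card_univ, Finset.card_eq_sum_card_fiberwise (f := f) (t := Finset.univ)
      (fun _ _ => Finset.mem_univ _), Finset.sum_congr rfl fun h _ => hfib h, Finset.sum_const,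
      Finset.card_univ, smul_eq_mul]
  have hsum : ∑ g, F (f g) = (Finset.univ.filter fun g => f g = 1).card * ∑ h, F h := by
    rw [← Finset.sum_fiberwise_of_maps_to (t := Finset.univ) (g := f)
      (fun _ _ => Finset.mem_univ _), Finset.mul_sum]
    refine Finset.sum_congr rfl fun h _ => ?_
    rw [Finset.sum_congr rfl (g := fun _ => F h)
      (by intro k hk; rw [(Finset.mem_filter.1 hk).2]), Finset.sum_const, hfib, nsmul_eq_mul]
  rw [hsum, hcard]
  push_cast
  ring

theorem sum_ite_isUnit {M A : Type*} [Monoid M] [Fintype M] [Fintype Mˣ] [AddCommMonoid A]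
    [DecidablePred (IsUnit : M → Prop)]
    (f : M → A) : ∑ m, (if IsUnit m then f m else 0) = ∑ u : Mˣ, f u := by
  rw [← Finset.sum_filter]
  symm
  refine Finset.sum_bij (fun u _ => (u : M)) ?_ ?_ ?_ ?_
  · intro u _
    simp
  · intro u _ v _ h
    exact Units.ext h
  · intro m hm
    obtain ⟨u, rfl⟩ := (Finset.mem_filter.1 hm).2
    exact ⟨u, Finset.mem_univ _, rfl⟩
  · intro u _
    rfl

/-- The residues modulo `2n` that are coprime to `n`. -/
def IsUnitMod (n : ℕ) (i : ZMod (2 * n)) : Prop :=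
  IsUnit (ZMod.castHom (dvd_mul_left n 2) (ZMod n) i)

theorem isUnitMod_one {n : ℕ} : IsUnitMod n 1 := by simp [IsUnitMod]

open scoped Classical in
theorem card_isUnitMod (n : ℕ) [NeZero n] :
    (Finset.univ.filter (IsUnitMod n)).card = 2 * n.totient := by
  rw [Finset.card_eq_sum_ones, Finset.sum_filter]
  have := ZMod.sum_comp_castHom_two_mul (n := n) (fun j => if IsUnit j then 1 else 0)
  rw [sum_ite_isUnit, Finset.sum_const, Finset.card_univ, ZMod.card_units_eq_totient, smul_eq_mul,
    smul_eq_mul, mul_one] at this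
  rw [← this]
  exact Finset.sum_congr rfl fun i _ => if_congr Iff.rfl rfl rfl

/-- The value at a character of order `e` of the sum of the character over the residues modulo
`2n` coprime to `n`. -/
noncomputable def coprimeCharSum (n e : ℕ) : ℝ :=
  if e ∣ n then 2 * ((ArithmeticFunction.moebius e : ℤ) : ℝ) * ((n.totient : ℝ) / (e.totient : ℝ))
  else 0

theorem ZMod.isPrimitiveRoot_stdAddChar {N : ℕ} [NeZero N] (k : ZMod N) :
    IsPrimitiveRoot (ZMod.stdAddChar k) (addOrderOf k) := by
  refine ⟨?_, fun l hl => addOrderOf_dvd_of_nsmul_eq_zero (ZMod.injective_stdAddChar ?_)⟩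
  · rw [← AddChar.map_nsmul_eq_pow, addOrderOf_nsmul_eq_zero, AddChar.map_zero_eq_one]
  · rw [AddChar.map_nsmul_eq_pow, hl, AddChar.map_zero_eq_one]

theorem ZMod.stdAddChar_mul {N : ℕ} [NeZero N] (k i : ZMod N) :
    ZMod.stdAddChar (k * i) = (ZMod.stdAddChar k) ^ i.val := by
  rw [← AddChar.map_nsmul_eq_pow, nsmul_eq_mul, ZMod.natCast_zmod_val, mul_comm]

open scoped Classical in
theorem sum_isUnitMod_stdAddChar {n : ℕ} [NeZero n] (k : ZMod (2 * n)) :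
    ∑ i, (if IsUnitMod n i then ZMod.stdAddChar (k * i) else 0) =
      (coprimeCharSum n (addOrderOf k) : ℂ) := by
  have hζ := ZMod.isPrimitiveRoot_stdAddChar k
  set ζ := ZMod.stdAddChar k
  set e := addOrderOf k
  have : NeZero e := ⟨(addOrderOf_pos k).ne'⟩
  unfold coprimeCharSum
  split_ifs with he
  -- When `e ∣ n` the character factors through `ZMod n` and then `ZMod e`. The first map
  -- contributes the factor `2`, the second, on units, `φ(n)/φ(e)`.
  · have hval : ∀ i : ZMod (2 * n), (ZMod.stdAddChar (k * i) : ℂ) =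
        AddChar.zmodChar e hζ.pow_eq_one (ZMod.castHom he (ZMod e)
          (ZMod.castHom (dvd_mul_left n 2) (ZMod n) i)) := by
      intro i
      conv_rhs => rw [← ZMod.natCast_zmod_val i, map_natCast, map_natCast, AddChar.zmodChar_apply']
      rw [ZMod.stdAddChar_mul]
    have h2 := ZMod.sum_comp_castHom_two_mul (n := n) (fun j => if IsUnit j then
      AddChar.zmodChar e hζ.pow_eq_one (ZMod.castHom he (ZMod e) j) else 0)
    rw [sum_ite_isUnit] at h2
    have h3 := MonoidHom.card_mul_sum_comp (ZMod.unitsMap_surjective he)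
      (fun v : (ZMod e)ˣ => AddChar.zmodChar e hζ.pow_eq_one (v : ZMod e))
    rw [hζ.sum_units_zmodChar, ZMod.card_units_eq_totient, ZMod.card_units_eq_totient] at h3
    simp only [ZMod.unitsMap_def, Units.coe_map, MonoidHom.coe_coe] at h3
    have h4 : (e.totient : ℂ) ≠ 0 :=
      Nat.cast_ne_zero.2 (Nat.totient_pos.2 (NeZero.pos e)).ne'
    simp only [hval]
    refine Eq.trans ?_ (h2.trans ?_)
    · exact Finset.sum_congr rfl fun i _ => if_congr Iff.rfl rfl rfl
    push_cast
    rw [nsmul_eq_mul, mul_assoc]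
    congr 1
    rw [mul_div_assoc', eq_div_iff h4]
    linear_combination h3
  · rw [Complex.ofReal_zero]
    have hn : ζ ^ n ≠ 1 := fun h => he (hζ.dvd_of_pow_eq_one _ h)
    -- Translation by `n` preserves the index set and multiplies each term by `ζ ^ n ≠ 1`.
    have key : ∑ i, (if IsUnitMod n i then (ZMod.stdAddChar (k * i) : ℂ) else 0) =
        ∑ i, ζ ^ n * (if IsUnitMod n i then (ZMod.stdAddChar (k * i) : ℂ) else 0) := by
      rw [← Equiv.sum_comp (Equiv.addRight (n : ZMod (2 * n)))]
      refine Finset.sum_congr rfl fun i _ => ?_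
      have hu : IsUnitMod n (i + n) ↔ IsUnitMod n i := by simp [IsUnitMod]
      rw [Equiv.coe_addRight, if_congr hu rfl rfl, mul_add, AddChar.map_add_eq_mul, mul_comm k n,
        ← nsmul_eq_mul, AddChar.map_nsmul_eq_pow, mul_ite, mul_zero, mul_comm]
    rw [← Finset.mul_sum] at key
    exact (mul_eq_zero.1 (by linear_combination key : (1 - ζ ^ n) * _ = 0)).resolve_left
      (sub_ne_zero.2 hn.symm)

/-! ### From an eigenbasis to the characteristic polynomial -/

theorem Matrix.charpoly_eq_prod_of_linearIndependent {K ι : Type*} [Field K] [Fintype ι]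
    [DecidableEq ι] [Nonempty ι] {M : Matrix ι ι K} {v : ι → ι → K} {d : ι → K}
    (hv : LinearIndependent K v) (h : ∀ i, M.mulVec (v i) = d i • v i) :
    M.charpoly = ∏ i, (Polynomial.X - Polynomial.C (d i)) := by
  let b := basisOfLinearIndependentOfCardEqFinrank hv (by simp)
  have hb : ∀ i, b i = v i := fun i => by simp [b]
  rw [← Matrix.charpoly_toLin', ← LinearMap.charpoly_toMatrix (Matrix.toLin' M) b,
    ← Matrix.charpoly_diagonal]
  congr 1
  ext i j
  rw [LinearMap.toMatrix_apply, Matrix.toLin'_apply, hb, h, ← hb, map_smul, b.repr_self,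
    Finsupp.smul_apply, Matrix.diagonal_apply, Finsupp.single_apply, smul_eq_mul]
  by_cases hij : i = j
  · subst hij; simp
  · simp [hij, Ne.symm hij]

theorem SimpleGraph.lapMatrix_map_ofReal {V : Type*} [Fintype V] [DecidableEq V]
    (G : SimpleGraph V) [DecidableRel G.Adj] :
    (G.lapMatrix ℝ).map (Complex.ofRealHom : ℝ → ℂ) = G.lapMatrix ℂ := by
  ext i j
  simp only [SimpleGraph.lapMatrix, SimpleGraph.degMatrix, Matrix.map_apply, Matrix.sub_apply,
    Matrix.diagonal_apply, SimpleGraph.adjMatrix_apply, map_sub]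
  congr 1 <;> split_ifs <;> simp

/-- The characters are complex while the matrix is real: the characteristic polynomial is factored
over `ℂ`, and the factorisation descends because the eigenvalues are real. -/
theorem Matrix.roots_charpoly_eq_map_of_linearIndependent {ι : Type*} [Fintype ι] [DecidableEq ι]
    [Nonempty ι] {M : Matrix ι ι ℝ} {v : ι → ι → ℂ} {d : ι → ℝ} (hv : LinearIndependent ℂ v)
    (h : ∀ i, (M.map (Complex.ofRealHom : ℝ → ℂ)).mulVec (v i) = (d i : ℂ) • v i) :
    M.charpoly.roots = ∑ i, {d i} := by
  have h1 := Matrix.charpoly_eq_prod_of_linearIndependent hv h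
  have h2 : M.charpoly = ∏ i, (Polynomial.X - Polynomial.C (d i)) := by
    apply Polynomial.map_injective Complex.ofRealHom Complex.ofRealHom.injective
    rw [← Matrix.charpoly_map, h1, Polynomial.map_prod]
    simp
  have h3 := Polynomial.roots_multiset_prod_X_sub_C (Finset.univ.val.map d)
  rw [Multiset.map_map] at h3
  rw [h2]
  refine h3.trans ?_
  rw [← Multiset.sum_map_singleton (Finset.univ.val.map d), Multiset.map_map]
  rfl

/-! ### An explicit eigenbasis -/

namespace QuaternionGroup

variable {n : ℕ} [NeZero n]

/-- The function on the dicyclic group given by `p` on the cyclic subgroup and by `q` on the other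
coset. -/
def glue {R : Type*} (p q : ZMod (2 * n) → R) : QuaternionGroup n → R
  | a i => p i
  | xa i => q i

theorem not_adj_a_a (hn : 2 ≤ n) (i j : ZMod (2 * n)) :
    ¬(generatingGraph (QuaternionGroup n)).Adj (a i) (a j) := by
  rw [generatingGraph_adj_iff hn, DihedralGroup.generatingGraph_adj_iff hn, toDihedral_a,
    toDihedral_a]
  exact DihedralGroup.closure_r_r_ne_top _ _

theorem adj_a_xa_iff (hn : 2 ≤ n) (i j : ZMod (2 * n)) :
    (generatingGraph (QuaternionGroup n)).Adj (a i) (xa j) ↔ IsUnitMod n i := by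
  rw [generatingGraph_adj_iff hn, DihedralGroup.generatingGraph_adj_iff hn, toDihedral_a,
    toDihedral_xa, DihedralGroup.closure_r_sr_eq_top_iff, IsUnitMod]

theorem adj_xa_a_iff (hn : 2 ≤ n) (i j : ZMod (2 * n)) :
    (generatingGraph (QuaternionGroup n)).Adj (xa i) (a j) ↔ IsUnitMod n j := by
  rw [SimpleGraph.adj_comm, adj_a_xa_iff hn]

theorem adj_xa_xa_iff (hn : 2 ≤ n) (i j : ZMod (2 * n)) :
    (generatingGraph (QuaternionGroup n)).Adj (xa i) (xa j) ↔ IsUnitMod n (j - i) := by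
  rw [generatingGraph_adj_iff hn, DihedralGroup.generatingGraph_adj_iff hn, toDihedral_xa,
    toDihedral_xa, DihedralGroup.closure_sr_sr_eq_top_iff, IsUnitMod, map_sub]

open scoped Classical in
theorem lapMatrix_mulVec_glue_a (hn : 2 ≤ n) (p q : ZMod (2 * n) → ℂ) (i : ZMod (2 * n)) :
    ((generatingGraph (QuaternionGroup n)).lapMatrix ℂ).mulVec (glue p q) (a i) =
      if IsUnitMod n i then 2 * n * p i - ∑ j, q j else 0 := by
  rw [SimpleGraph.lapMatrix_mulVec_apply_eq_sum_ite, sum_eq_sum_a_add_sum_xa]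
  simp only [not_adj_a_a hn, adj_a_xa_iff hn, if_false, Finset.sum_const_zero, zero_add, glue]
  split_ifs with h
  · rw [Finset.sum_sub_distrib, Finset.sum_const, Finset.card_univ, ZMod.card, nsmul_eq_mul]
    push_cast
    rfl
  · simp

open scoped Classical in
theorem lapMatrix_mulVec_glue_xa (hn : 2 ≤ n) (p q : ZMod (2 * n) → ℂ) (i : ZMod (2 * n)) :
    ((generatingGraph (QuaternionGroup n)).lapMatrix ℂ).mulVec (glue p q) (xa i) =
      4 * n.totient * q i - ∑ j, (if IsUnitMod n j then p j else 0) -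
        ∑ j, (if IsUnitMod n j then q (i + j) else 0) := by
  rw [SimpleGraph.lapMatrix_mulVec_apply_eq_sum_ite, sum_eq_sum_a_add_sum_xa]
  simp only [adj_xa_a_iff hn, adj_xa_xa_iff hn, glue]
  -- Centring the sum at `i` makes it a convolution. The degree `4φ(n)` is `2φ(n)` from each coset.
  rw [← Equiv.sum_comp (Equiv.addLeft i) fun j => if IsUnitMod n (j - i) then q i - q j else 0]
  simp only [Equiv.coe_addLeft, add_sub_cancel_left]
  simp only [← Finset.sum_filter, Finset.sum_sub_distrib, Finset.sum_const, card_isUnitMod,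
    nsmul_eq_mul]
  push_cast
  ring

open scoped Classical in
/-- The cyclic part of the eigenvector of the Laplacian indexed by `a s`. -/
noncomputable def cyclicPart (s j : ZMod (2 * n)) : ℂ :=
  -- The residue `1` serves as reference unit: differences with it leave its own slot free for the
  -- indicator of all units, which extends to the indicator of the non-isolated vertices.
  if s = 1 then (if IsUnitMod n j then 1 else 0)
  else if IsUnitMod n s then (if j = s then 1 else 0) - (if j = 1 then 1 else 0)
  else (if j = s then 1 else 0)

open scoped Classical in
/-- A basis of eigenvectors of the Laplacian of the generating graph of the dicyclic group. -/
noncomputable def eigenvector : QuaternionGroup n → QuaternionGroup n → ℂ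
  | a s => glue (cyclicPart s) fun _ => if s = 1 then 1 else 0
  -- The slot of the trivial character holds the vector with weights `n` on the `2φ(n)` unit
  -- rotations and `-φ(n)` on the `2n` elements `xa j`, hence of total sum zero.
  | xa k => glue (fun j => if k = 0 then (if IsUnitMod n j then (n : ℂ) else 0) else 0)
      fun j => if k = 0 then -(n.totient : ℂ) else ZMod.stdAddChar (k * j)

open scoped Classical in
/-- The eigenvalue of `eigenvector`. -/
noncomputable def eigenvalue : QuaternionGroup n → ℝ
  | a s => if s = 1 then 0 else if IsUnitMod n s then 2 * n else 0
  | xa k => if k = 0 then 2 * (n + n.totient) else 4 * n.totient - coprimeCharSum n (addOrderOf k)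

open scoped Classical in
theorem sum_isUnitMod_cyclicPart (s : ZMod (2 * n)) :
    ∑ j, (if IsUnitMod n j then cyclicPart s j else 0) =
      if s = 1 then 2 * (n.totient : ℂ) else 0 := by
  unfold cyclicPart
  split_ifs with h1 h2
  · rw [← Finset.sum_filter]
    simp [card_isUnitMod]
  · rw [← Finset.sum_filter, Finset.sum_sub_distrib, Finset.sum_ite_eq', Finset.sum_ite_eq']
    simp [h2, isUnitMod_one]
  · rw [← Finset.sum_filter, Finset.sum_ite_eq']
    simp [h2]

theorem lapMatrix_mulVec_eigenvector (hn : 2 ≤ n) (g : QuaternionGroup n) :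
    ((generatingGraph (QuaternionGroup n)).lapMatrix ℂ).mulVec (eigenvector g) =
      (eigenvalue g : ℂ) • eigenvector g := by
  classical
  ext h
  rw [Pi.smul_apply, smul_eq_mul]
  obtain s | k := g <;> obtain i | i := h
  · simp only [eigenvector]
    rw [lapMatrix_mulVec_glue_a hn]
    simp only [glue, eigenvalue, cyclicPart]
    by_cases h1 : s = 1
    · simp [h1]
      grind
    · by_cases h2 : IsUnitMod n s
      · by_cases h3 : IsUnitMod n i
        · simp [h1, h2, h3]
        · have h4 : i ≠ s := by rintro rfl; exact h3 h2
          have h5 : i ≠ 1 := by rintro rfl; exact h3 isUnitMod_one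
          simp [h3, h4, h5]
      · have h4 : IsUnitMod n i → i ≠ s := by rintro h3 rfl; exact h2 h3
        simp [h1, h2]
        grind
  · simp only [eigenvector]
    rw [lapMatrix_mulVec_glue_xa hn, sum_isUnitMod_cyclicPart, ← Finset.sum_filter,
      Finset.sum_const, card_isUnitMod]
    simp only [glue, eigenvalue]
    by_cases h1 : s = 1
    · simp [h1]
      ring
    · simp [h1]
  · simp only [eigenvector]
    rw [lapMatrix_mulVec_glue_a hn]
    simp only [glue, eigenvalue]
    by_cases h1 : k = 0
    · simp [h1]
      split_ifs
      · ring
      · rfl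
    -- A nontrivial character sums to zero, so the `xa` coset does not affect the rotations.
    · have h2 : ∑ j, (ZMod.stdAddChar (k * j) : ℂ) = 0 := by
        have := AddChar.sum_mulShift k (ZMod.isPrimitive_stdAddChar (2 * n))
        simpa [h1, mul_comm] using this
      simp [h1, h2]
  · simp only [eigenvector]
    rw [lapMatrix_mulVec_glue_xa hn]
    simp only [glue, eigenvalue]
    by_cases h1 : k = 0
    · simp only [h1, if_true, ← Finset.sum_filter, Finset.sum_const, Finset.filter_filter,
        and_self, card_isUnitMod, nsmul_eq_mul]
      push_cast
      ring
    · simp only [h1, if_false, mul_add, AddChar.map_add_eq_mul, ite_self, Finset.sum_const_zero,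
        sub_zero, ← mul_ite_zero, ← Finset.mul_sum, sum_isUnitMod_stdAddChar]
      push_cast
      ring

theorem linearIndependent_stdAddChar (N : ℕ) [NeZero N] :
    LinearIndependent ℂ fun k j : ZMod N => (ZMod.stdAddChar (k * j) : ℂ) := by
  have h := (AddChar.linearIndependent (ZMod N) ℂ).comp
    (fun k => AddChar.mulShift ZMod.stdAddChar k) fun k l hkl => by
      have := DFunLike.congr_fun hkl (1 : ZMod N)
      simpa [AddChar.mulShift_apply] using ZMod.injective_stdAddChar this
  exact h

theorem linearIndependent_eigenvector :
    LinearIndependent ℂ (eigenvector : QuaternionGroup n → QuaternionGroup n → ℂ) := by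
  classical
  rw [Fintype.linearIndependent_iff]
  intro c hc
  have hφ : (n.totient : ℂ) ≠ 0 := Nat.cast_ne_zero.2 (Nat.totient_pos.2 (NeZero.pos n)).ne'
  have hsum : ((n.totient + n : ℕ) : ℂ) ≠ 0 :=
    Nat.cast_ne_zero.2 (by have := NeZero.pos n; omega)
  -- Restricted to the `xa` coset, the relation is one between characters. Both `a 1` and `xa 0` are
  -- constant there, so they share the trivial coefficient.
  have hchar : ∀ k, (if k = 0 then c (a 1) - n.totient * c (xa 0) else c (xa k)) = 0 := by
    refine Fintype.linearIndependent_iff.1 (linearIndependent_stdAddChar (2 * n)) _ ?_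
    ext j
    have h := congrFun hc (xa j)
    rw [Finset.sum_apply, sum_eq_sum_a_add_sum_xa] at h
    simp only [Pi.smul_apply, smul_eq_mul, eigenvector, glue, mul_ite, mul_one, mul_zero,
      Finset.sum_ite_eq', Finset.mem_univ, if_true, Pi.zero_apply] at h
    rw [Finset.sum_apply, Pi.zero_apply, ← h,
      ← Finset.add_sum_erase _ _ (Finset.mem_univ (0 : ZMod (2 * n))),
      ← Finset.add_sum_erase _ _ (Finset.mem_univ (0 : ZMod (2 * n))), ← add_assoc]
    congr 1
    · simp
      ring
    · refine Finset.sum_congr rfl fun k hk => ?_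
      have hk0 := Finset.ne_of_mem_erase hk
      simp [hk0]
  have hxa : ∀ k, k ≠ 0 → c (xa k) = 0 := fun k hk => by simpa [hk] using hchar k
  have h0 : c (a 1) - n.totient * c (xa 0) = 0 := by simpa using hchar 0
  have ha : ∀ i, ∑ s, c (a s) * cyclicPart s i +
      (if IsUnitMod n i then c (xa 0) * n else 0) = 0 := by
    intro i
    have h := congrFun hc (a i)
    rw [Finset.sum_apply, sum_eq_sum_a_add_sum_xa] at h
    simpa [eigenvector, glue] using h
  -- Summing over unit rotations kills the differences. With `h0` this gives `(φ(n) + n) * c (xa 0)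
  -- = 0`.
  have htotal : c (a 1) + n * c (xa 0) = 0 := by
    have h : ∑ i, (if IsUnitMod n i then (∑ s, c (a s) * cyclicPart s i +
      (if IsUnitMod n i then c (xa 0) * n else 0)) else 0) = 0 :=
      Finset.sum_eq_zero fun i _ => by rw [ha, ite_self]
    rw [← Finset.sum_filter, Finset.sum_add_distrib, Finset.sum_comm] at h
    simp only [← Finset.mul_sum] at h
    simp only [Finset.sum_filter, sum_isUnitMod_cyclicPart] at h
    simp only [mul_ite, mul_zero, Finset.sum_ite_eq', Finset.mem_univ, if_true,
      ← Finset.sum_filter, Finset.filter_filter, and_self, Finset.sum_const, card_isUnitMod,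
      nsmul_eq_mul] at h
    push_cast at h
    exact (mul_eq_zero.1 (by linear_combination h : (2 * (n.totient : ℂ)) * _ = 0)).resolve_left
      (mul_ne_zero two_ne_zero hφ)
  have hx0 : c (xa 0) = 0 := by
    refine (mul_eq_zero.1 ?_).resolve_left hsum
    push_cast
    linear_combination htotal - h0
  have ha1 : c (a 1) = 0 := by rw [hx0] at h0; simpa using h0
  rintro (i | k)
  · by_cases h1 : i = 1
    · rw [h1, ha1]
    · have h := ha i
      rw [hx0, zero_mul, ite_self, add_zero, Finset.sum_eq_single i] at h
      · simpa [cyclicPart, h1] using h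
      · intro s _ hs
        by_cases h2 : s = 1
        · rw [h2, ha1, zero_mul]
        · simp [cyclicPart, h1, h2, Ne.symm hs]
      · simp
  · by_cases hk : k = 0
    · rw [hk, hx0]
    · exact hxa k hk

theorem eigenvalueMultiset_generatingLaplacian (hn : 2 ≤ n) :
    eigenvalueMultiset (generatingLaplacian (QuaternionGroup n)) =
      ∑ g : QuaternionGroup n, {eigenvalue g} := by
  refine Matrix.roots_charpoly_eq_map_of_linearIndependent linearIndependent_eigenvector fun g => ?_
  unfold generatingLaplacian
  rw [SimpleGraph.lapMatrix_map_ofReal, lapMatrix_mulVec_eigenvector hn]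

end QuaternionGroup

/-! ### Counting multiplicities -/

theorem ZMod.sum_comp_addOrderOf {N : ℕ} [NeZero N] {M : Type*} [AddCommMonoid M] (F : ℕ → M) :
    ∑ k ∈ (Finset.univ : Finset (ZMod N)).erase 0, F (addOrderOf k) =
      ∑ e ∈ N.divisors.erase 1, e.totient • F e := by
  classical
  rw [← Finset.sum_fiberwise_of_maps_to (t := N.divisors.erase 1) (g := addOrderOf)]
  · refine Finset.sum_congr rfl fun e he => ?_
    rw [Finset.mem_erase, Nat.mem_divisors] at he
    rw [Finset.sum_congr rfl (g := fun _ => F e)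
      (by intro k hk; rw [(Finset.mem_filter.1 hk).2]), Finset.sum_const,
      ← IsAddCyclic.card_addOrderOf_eq_totient (α := ZMod N) (by rw [ZMod.card]; exact he.2.1)]
    congr 2
    ext k
    simp only [Finset.mem_filter, Finset.mem_erase, Finset.mem_univ, and_true, true_and,
      and_iff_right_iff_imp]
    rintro rfl hk
    exact he.1 (AddMonoid.addOrderOf_eq_one_iff.2 hk)
  · intro k hk
    rw [Finset.mem_erase, Nat.mem_divisors, Ne, AddMonoid.addOrderOf_eq_one_iff]
    refine ⟨Finset.ne_of_mem_erase hk, ?_, NeZero.ne N⟩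
    simpa using addOrderOf_dvd_card (x := k)

/-- The divisors of the radical are the squarefree divisors of `n`. Every other divisor of `2n` has
character sum zero, either because `μ` vanishes or because it does not divide `n`; by `∑ φ(e) = N`
over `e ∣ N`, these account for `2n - n₀` characters. -/
theorem sum_divisors_coprimeCharSum {n : ℕ} [NeZero n] :
    ∑ e ∈ (2 * n).divisors.erase 1,
        e.totient • ({4 * (n.totient : ℝ) - coprimeCharSum n e} : Multiset ℝ) =
      ∑ d ∈ (UniqueFactorizationMonoid.radical n).divisors.erase 1,
          Multiset.replicate (Nat.totient d)
            (4 * (Nat.totient n : ℝ)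
              - 2 * ((ArithmeticFunction.moebius d : ℤ) : ℝ)
                  * ((Nat.totient n : ℝ) / (Nat.totient d : ℝ)))
      + Multiset.replicate (2 * n - UniqueFactorizationMonoid.radical n)
          (4 * (Nat.totient n : ℝ)) := by
  have hr : UniqueFactorizationMonoid.radical n ∣ n := UniqueFactorizationMonoid.radical_dvd_self
  have hr0 : UniqueFactorizationMonoid.radical n ≠ 0 := (Nat.radical_pos n).ne'
  have hr2 : UniqueFactorizationMonoid.radical n ∣ 2 * n := hr.mul_left 2
  have h2n : 2 * n ≠ 0 := mul_ne_zero two_ne_zero (NeZero.ne n)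
  have hsub : (UniqueFactorizationMonoid.radical n).divisors ⊆ (2 * n).divisors :=
    Nat.divisors_subset_of_dvd h2n hr2
  rw [← Finset.sum_sdiff (Finset.erase_subset_erase 1 hsub), add_comm]
  congr 1
  · refine Finset.sum_congr rfl fun e he => ?_
    rw [Finset.mem_erase, Nat.mem_divisors] at he
    rw [Multiset.nsmul_singleton, coprimeCharSum, if_pos (he.2.1.trans hr)]
  · have hset : (2 * n).divisors.erase 1 \ (UniqueFactorizationMonoid.radical n).divisors.erase 1 =
        (2 * n).divisors \ (UniqueFactorizationMonoid.radical n).divisors := by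
      ext e
      have : (1 : ℕ) ∈ (UniqueFactorizationMonoid.radical n).divisors := Nat.one_mem_divisors.2 hr0
      by_cases he : e = 1
      · simp [he, this]
      · simp [he]
    have hval : ∀ e ∈ (2 * n).divisors \ (UniqueFactorizationMonoid.radical n).divisors,
        coprimeCharSum n e = 0 := by
      intro e he
      rw [Finset.mem_sdiff, Nat.mem_divisors, Nat.mem_divisors] at he
      unfold coprimeCharSum
      split_ifs with hen
      · rw [ArithmeticFunction.moebius_eq_zero_of_not_squarefree]
        · simp
        · intro hsq
          exact he.2 ⟨(UniqueFactorizationMonoid.dvd_radical_iff hsq.isRadical (NeZero.ne n)).2 hen,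
            hr0⟩
      · rfl
    have hcount : ∑ e ∈ (2 * n).divisors \ (UniqueFactorizationMonoid.radical n).divisors,
        e.totient = 2 * n - UniqueFactorizationMonoid.radical n := by
      have := Finset.sum_sdiff (f := Nat.totient) hsub
      rw [Nat.sum_totient, Nat.sum_totient] at this
      omega
    rw [hset, ← hcount, ← Multiset.nsmul_singleton, Finset.sum_smul]
    refine Finset.sum_congr rfl fun e he => ?_
    rw [hval e he, sub_zero]

namespace QuaternionGroup

theorem sum_eigenvalue_a {n : ℕ} [NeZero n] :
    ∑ s : ZMod (2 * n), ({eigenvalue (a s)} : Multiset ℝ) =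
      Multiset.replicate (2 * (n - n.totient) + 1) 0 +
        Multiset.replicate (2 * n.totient - 1) (2 * (n : ℝ)) := by
  classical
  have hle := Nat.totient_le n
  have hpos := Nat.totient_pos.2 (NeZero.pos n)
  have h1 : (1 : ZMod (2 * n)) ∈ Finset.univ.filter (IsUnitMod n) := by simp [isUnitMod_one]
  have hcard : (Finset.univ.filter fun s => ¬IsUnitMod n s).card = 2 * (n - n.totient) := by
    have := Finset.card_filter_add_card_filter_not (s := Finset.univ) (IsUnitMod n)
    rw [card_isUnitMod, Finset.card_univ, ZMod.card] at this
    omega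
  -- The unit `s = 1` has eigenvalue `0`, which explains both the `+ 1` and the `- 1`.
  rw [← Finset.sum_filter_add_sum_filter_not Finset.univ (IsUnitMod n),
    ← Finset.add_sum_erase _ _ h1,
    Finset.sum_congr (s₁ := (Finset.univ.filter (IsUnitMod n)).erase 1) rfl
      (g := fun _ => {2 * (n : ℝ)}),
    Finset.sum_congr (s₁ := Finset.univ.filter fun s => ¬IsUnitMod n s) rfl
      (g := fun _ => {(0 : ℝ)}), Finset.sum_const, Finset.sum_const, hcard,
    Finset.card_erase_of_mem h1, card_isUnitMod, Multiset.replicate_add,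
    Multiset.nsmul_singleton, Multiset.nsmul_singleton, Multiset.replicate_one]
  · simp only [eigenvalue, if_true]
    abel
  · intro s hs
    have h := (Finset.mem_filter.1 hs).2
    simp [eigenvalue, h]
  · intro s hs
    rw [Finset.mem_erase, Finset.mem_filter] at hs
    simp [eigenvalue, hs.1, hs.2.2]

theorem sum_eigenvalue_xa {n : ℕ} [NeZero n] :
    ∑ k : ZMod (2 * n), ({eigenvalue (xa k)} : Multiset ℝ) =
      {2 * ((n : ℝ) + n.totient)} + ∑ e ∈ (2 * n).divisors.erase 1,
        e.totient • ({4 * (n.totient : ℝ) - coprimeCharSum n e} : Multiset ℝ) := by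
  rw [← Finset.add_sum_erase _ _ (Finset.mem_univ (0 : ZMod (2 * n))),
    ← ZMod.sum_comp_addOrderOf fun e =>
      ({4 * (n.totient : ℝ) - coprimeCharSum n e} : Multiset ℝ)]
  congr 1
  · simp [eigenvalue]
  · refine Finset.sum_congr rfl fun k hk => ?_
    simp [eigenvalue, Finset.ne_of_mem_erase hk]

end QuaternionGroup

theorem mainTheorem2 (n : ℕ) [NeZero n] (hn : 2 ≤ n) :
    (∀ l : ℝ,
      Module.End.HasEigenvalue (Matrix.toLin' (generatingLaplacian (DihedralGroup n))) l →
      Module.End.HasEigenvalue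
        (Matrix.toLin' (generatingLaplacian (QuaternionGroup n))) (2 * l)) ∧
    eigenvalueMultiset (generatingLaplacian (QuaternionGroup n)) =
      Multiset.replicate (2 * (n - Nat.totient n) + 1) (0 : ℝ)
      + ∑ d ∈ (UniqueFactorizationMonoid.radical n).divisors.erase 1,
          Multiset.replicate (Nat.totient d)
            (4 * (Nat.totient n : ℝ)
              - 2 * ((ArithmeticFunction.moebius d : ℤ) : ℝ)
                  * ((Nat.totient n : ℝ) / (Nat.totient d : ℝ)))
      + Multiset.replicate (2 * n - UniqueFactorizationMonoid.radical n) (4 * (Nat.totient n : ℝ))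
      + Multiset.replicate (2 * Nat.totient n - 1) (2 * (n : ℝ))
      + Multiset.replicate 1 (2 * ((n : ℝ) + (Nat.totient n : ℝ))) := by
  refine ⟨fun l hl => QuaternionGroup.hasEigenvalue_two_mul hn hl, ?_⟩
  rw [QuaternionGroup.eigenvalueMultiset_generatingLaplacian hn,
    QuaternionGroup.sum_eq_sum_a_add_sum_xa, QuaternionGroup.sum_eigenvalue_a,
    QuaternionGroup.sum_eigenvalue_xa, sum_divisors_coprimeCharSum, Multiset.replicate_one]
  abel
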